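/- For $f,g:\mathbb F_2^n\to\mathbb R$ let $\langle f,g\rangle=2^{-n}\sum_x f(x)g(x)$ and $\|f\|_2=\sqrt{\langle f,f\rangle}$. For $\alpha\in\mathbb F_2^n$ let $\chi_\alpha(x)=(-1)^{\alpha\cdot x}$ and $\hat f(\alpha)=\langle f,\chi_\alpha\rangle$. Call $f$ $s$-sparse if at most $s$ of its Fourier coefficients $\hat f(\alpha)$ are nonzero, and $\tfrac13$-far from $s$-sparse in $\ell_2^2$ if $\inf_g\|f-g\|_2^2\ge\tfrac13$, the infimum being over all $s$-sparse $g$. A (randomized) non-adaptive algorithm with $q$ queries chooses points $x_1,\dots,x_q\in\mathbb F_2^n$ as a function of its random seed alone, receives $f(x_1),\dots,f(x_q)$, and accepts or rejects depending (measurably) on the seed and these values. Theorem. There is an absolute constant $c>0$ such that the following holds for all integers $n\ge1$ and $0\le s\le 2^{n-1}$ and all real $\varepsilon>0$. Suppose that a non-adaptive algorithm with $q$ queries satisfies, for every $f:\mathbb F_2^n\to\mathbb R$ with $1-\varepsilon\le\|f\|_2^2\le1+\varepsilon$: if $f$ is $s$-sparse, then it accepts with probability at least $\tfrac23$; if $f$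 is $\tfrac13$-far from $s$-sparse in $\ell_2^2$, then it rejects with probability at least $\tfrac23$. Then $q\ge c\sqrt s$. -/

import Mathlib

open MeasureTheory

namespace FourierSparsity

noncomputable section

/-- The vector space `𝔽₂ⁿ`. -/
abbrev F2 (n : ℕ) : Type := Fin n → ZMod 2

/-- The character `χ_α(x) = (-1)^(α · x)`. -/
def chi {n : ℕ} (α x : F2 n) : ℝ := (-1) ^ (dotProduct α x).val

/-- The inner product `⟨f, g⟩ = 2⁻ⁿ ∑ₓ f(x) g(x)`. -/
def innerE {n : ℕ} (f g : F2 n → ℝ) : ℝ := (1 / 2 ^ n) * ∑ x, f x * g x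

/-- The norm `‖f‖₂ = √⟨f, f⟩`. -/
def l2Norm {n : ℕ} (f : F2 n → ℝ) : ℝ := Real.sqrt (innerE f f)

/-- The Fourier coefficient of `f` at `α`, i.e. `2⁻ⁿ ∑ₓ f(x) χ_α(x)`. -/
def fourierCoeff {n : ℕ} (f : F2 n → ℝ) (α : F2 n) : ℝ := innerE f (chi α)

/-- The set of Fourier `s`-sparse functions: at most `s` Fourier coefficients are nonzero. -/
def sparse (n s : ℕ) : Set (F2 n → ℝ) := {f | {α | fourierCoeff f α ≠ 0}.ncard ≤ s}

/-- The `ℓ₂`-distance from `f` to a class `C` of functions. -/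
def l2Dist {n : ℕ} (f : F2 n → ℝ) (C : Set (F2 n → ℝ)) : ℝ :=
  sInf ((fun g => l2Norm (f - g)) '' C)

/-- `f` is `δ`-far from the class `C` in `ℓ₂²`. -/
def IsFar {n : ℕ} (δ : ℝ) (f : F2 n → ℝ) (C : Set (F2 n → ℝ)) : Prop :=
  δ ≤ l2Dist f C ^ 2

/-- A randomized non-adaptive algorithm making `q` queries to a function `𝔽₂ⁿ → ℝ`. It draws a
random seed `ω`; the query points depend on the seed alone; the output bit depends on the seed and
on the `q` answers. There is no bound on its computational power. Points may be queried repeatedly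
and answers may be ignored, so that algorithms making at most `q` queries are included. -/
structure NonAdaptiveAlgorithm (n q : ℕ) where
  /-- The space of random seeds. -/
  Seed : Type*
  [measurableSpace : MeasurableSpace Seed]
  /-- The distribution of the seed. -/
  law : Measure Seed
  [isProbabilityMeasure : IsProbabilityMeasure law]
  /-- The query points. -/
  query : Seed → Fin q → F2 n
  measurableSet_query : ∀ ξ : Fin q → F2 n, MeasurableSet {ω | query ω = ξ}
  /-- The output bit, given the seed and the answers; `true` means accept. -/
  output : Seed → (Fin q → ℝ) → Bool
  measurable_output : Measurable fun p : Seed × (Fin q → ℝ) => output p.1 p.2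

/-- The output of the algorithm on input `f` and seed `ω`. -/
def NonAdaptiveAlgorithm.run {n q : ℕ} (A : NonAdaptiveAlgorithm n q) (f : F2 n → ℝ)
    (ω : A.Seed) : Bool :=
  A.output ω fun i => f (A.query ω i)

/-- The probability that the algorithm outputs the bit `b` on input `f`. -/
def NonAdaptiveAlgorithm.prob {n q : ℕ} (A : NonAdaptiveAlgorithm n q) (f : F2 n → ℝ)
    (b : Bool) : ℝ :=
  letI := A.measurableSpace
  A.law.real {ω | A.run f ω = b}

/-- On every input `f` with `‖f‖₂² = 1 ± ε`, the algorithm accepts with probability at least `2/3`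
if `f` belongs to `C`, and rejects with probability at least `2/3` if `f` is `δ`-far from `C` in
`ℓ₂²`. -/
def NonAdaptiveAlgorithm.Distinguishes {n q : ℕ} (A : NonAdaptiveAlgorithm n q)
    (C : Set (F2 n → ℝ)) (δ ε : ℝ) : Prop :=
  ∀ f : F2 n → ℝ, |l2Norm f ^ 2 - 1| ≤ ε →
    (f ∈ C → 2 / 3 ≤ A.prob f true) ∧ (IsFar δ f C → 2 / 3 ≤ A.prob f false)

end

end FourierSparsity

/-!
Any two functions of small support look alike to a non-adaptive algorithm: for a random `z`, the
translate of `f` by `z` vanishes at all `q` query points except with probability at most `q` times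
the density of the support of `f`, and where it does the algorithm acts as on the zero function.
A normalized subcube of codimension `k` has support density `2⁻ᵏ` and only `2ᵏ` nonzero Fourier
coefficients, while a normalized point mass is far from sparse, because by Cauchy–Schwarz all its
Fourier coefficients are small. With `2ᵏ ≤ s < 2ᵏ⁺¹`, telling these two apart takes
order `s` queries.
-/

namespace FourierSparsity

open Finset
open scoped translate

variable {n s q : ℕ}

section Character

lemma chi_comm (α x : F2 n) : chi α x = chi x α := by
  rw [chi, chi, dotProduct_comm]

lemma chi_zero_right (α : F2 n) : chi α 0 = 1 := by
  simp [chi]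

lemma chi_add (α x y : F2 n) : chi α (x + y) = chi α x * chi α y := by
  rw [chi, dotProduct_add, ZMod.val_add, ← neg_one_pow_eq_pow_mod_two, pow_add, chi, chi]

lemma chi_sq (α x : F2 n) : chi α x ^ 2 = 1 := by
  rw [chi, ← pow_mul, mul_comm, pow_mul, neg_one_sq, one_pow]

lemma chi_single_one {α : F2 n} {j : Fin n} (hj : α j ≠ 0) : chi α (Pi.single j 1) = -1 := by
  have : α j = 1 := Fin.eq_one_of_ne_zero _ hj
  simp [chi, this, ZMod.val_one]

end Character

section Translation

lemma innerE_translate_self (z : F2 n) (f : F2 n → ℝ) :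
    innerE (τ z f) (τ z f) = innerE f f := by
  simp only [innerE, translate_apply, Equiv.sum_comp (Equiv.subRight z) fun x => f x * f x,
    ← Equiv.subRight_apply]

lemma fourierCoeff_translate (z : F2 n) (f : F2 n → ℝ) (α : F2 n) :
    fourierCoeff (τ z f) α = chi α z * fourierCoeff f α := by
  rw [fourierCoeff, innerE, ← Equiv.sum_comp (Equiv.addRight z), fourierCoeff, innerE,
    mul_left_comm, mul_sum (f := fun x => f x * chi α x)]
  simp only [Equiv.coe_addRight, translate_apply, add_sub_cancel_right, chi_add, mul_comm,
    mul_left_comm]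

lemma fourierCoeff_eq_zero_of_translate_eq {f : F2 n → ℝ} {v α : F2 n} (hf : τ v f = f)
    (hv : chi α v ≠ 1) : fourierCoeff f α = 0 := by
  have h := fourierCoeff_translate v f α
  rw [hf] at h
  by_contra h0
  exact hv ((right_eq_mul₀ h0).mp h)

lemma translate_mem_sparse (z : F2 n) {f : F2 n → ℝ} (hf : f ∈ sparse n s) :
    τ z f ∈ sparse n s := by
  have chi_ne_zero (α : F2 n) : chi α z ≠ 0 := pow_ne_zero _ (by norm_num)
  simpa [sparse, fourierCoeff_translate, chi_ne_zero] using hf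

end Translation

section Parseval

lemma card_F2 (n : ℕ) : Fintype.card (F2 n) = 2 ^ n := by
  rw [Fintype.card_fun, ZMod.card, Fintype.card_fin]

lemma sum_chi (α : F2 n) : ∑ x, chi α x = if α = 0 then 2 ^ n else 0 := by
  split_ifs with hα
  · simp [hα, chi_comm 0, chi_zero_right, ZMod.card]
  · obtain ⟨j, hj⟩ := Function.ne_iff.mp hα
    have h : fourierCoeff 1 α = 0 :=
      fourierCoeff_eq_zero_of_translate_eq (v := Pi.single j 1) rfl (by
        rw [chi_single_one hj]; norm_num)
    simpa [fourierCoeff, innerE] using h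

lemma sum_chi_mul_chi (x y : F2 n) :
    ∑ α, chi α x * chi α y = if x = y then 2 ^ n else 0 := by
  have add_eq_zero_iff : x + y = 0 ↔ x = y := by
    simp only [funext_iff, Pi.add_apply, Pi.zero_apply, CharTwo.add_eq_zero]
  simp only [← chi_add, chi_comm _ (x + y), sum_chi, add_eq_zero_iff]

lemma sum_fourierCoeff_sq (f : F2 n → ℝ) : ∑ α, fourierCoeff f α ^ 2 = innerE f f := by
  calc
    ∑ α, fourierCoeff f α ^ 2
      = ∑ α, ∑ x, ∑ y, (1 / 2 ^ n) ^ 2 * (f x * f y) * (chi α x * chi α y) := by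
        refine sum_congr rfl fun α _ => ?_
        rw [fourierCoeff, innerE, mul_pow, sq (∑ x, _), sum_mul_sum, mul_sum]
        simp only [mul_sum]
        exact sum_congr rfl fun x _ => sum_congr rfl fun y _ => by ring
    _ = ∑ x, ∑ y, (1 / 2 ^ n) ^ 2 * (f x * f y) * ∑ α, chi α x * chi α y := by
        rw [sum_comm]
        refine sum_congr rfl fun x _ => ?_
        rw [sum_comm]
        simp only [mul_sum]
    _ = innerE f f := by
        simp only [sum_chi_mul_chi, mul_ite, mul_zero, sum_ite_eq, mem_univ, if_true, innerE,
          mul_sum]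
        exact sum_congr rfl fun x _ => by field_simp

end Parseval

section Distance

lemma innerE_self_nonneg (f : F2 n → ℝ) : 0 ≤ innerE f f :=
  mul_nonneg (by positivity) (sum_nonneg fun _ _ => mul_self_nonneg _)

lemma l2Norm_sq (f : F2 n → ℝ) : l2Norm f ^ 2 = innerE f f :=
  Real.sq_sqrt (innerE_self_nonneg f)

lemma isFar_of_forall_le_innerE {δ : ℝ} {f : F2 n → ℝ} {C : Set (F2 n → ℝ)} (hC : C.Nonempty)
    (h : ∀ g ∈ C, δ ≤ innerE (f - g) (f - g)) : IsFar δ f C := by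
  have : √δ ≤ l2Dist f C := by
    refine le_csInf (hC.image _) ?_
    rintro _ ⟨g, hg, rfl⟩
    exact Real.sqrt_le_sqrt (h g hg)
  exact (Real.sqrt_le_iff.mp this).2

lemma zero_mem_sparse (n s : ℕ) : 0 ∈ sparse n s := by
  simp [sparse, fourierCoeff, innerE]

lemma fourierCoeff_sub (f g : F2 n → ℝ) (α : F2 n) :
    fourierCoeff (f - g) α = fourierCoeff f α - fourierCoeff g α := by
  simp only [fourierCoeff, innerE, Pi.sub_apply, sub_mul, sum_sub_distrib, mul_sub]

lemma isFar_sparse_of_fourierCoeff_sq_le {f : F2 n → ℝ} {B : ℝ}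
    (hB : ∀ α, fourierCoeff f α ^ 2 ≤ B) : IsFar (innerE f f - s * B) f (sparse n s) := by
  refine isFar_of_forall_le_innerE ⟨0, zero_mem_sparse n s⟩ fun g hg => ?_
  let T : Finset (F2 n) := {α | fourierCoeff g α ≠ 0}
  have hT : (#T : ℝ) ≤ s := by
    have : (T : Set (F2 n)).ncard ≤ s := by simpa [T, sparse] using hg
    exact_mod_cast Set.ncard_coe_finset T ▸ this
  have spectrum_on_T : ∑ α ∈ T, fourierCoeff f α ^ 2 ≤ s * B :=
    calc
      ∑ α ∈ T, fourierCoeff f α ^ 2 ≤ #T * B := by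
        simpa using sum_le_card_nsmul T _ B fun α _ => hB α
      _ ≤ s * B := mul_le_mul_of_nonneg_right hT ((sq_nonneg _).trans (hB 0))
  calc
    innerE f f - s * B ≤ innerE f f - ∑ α ∈ T, fourierCoeff f α ^ 2 := by gcongr
    _ = ∑ α ∈ Tᶜ, fourierCoeff f α ^ 2 := by
      rw [← sum_fourierCoeff_sq, ← sum_add_sum_compl T, add_sub_cancel_left]
    _ = ∑ α ∈ Tᶜ, fourierCoeff (f - g) α ^ 2 := by
      refine sum_congr rfl fun α hα => ?_
      have : fourierCoeff g α = 0 := by simpa [T] using hα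
      rw [fourierCoeff_sub, this, sub_zero]
    _ ≤ ∑ α, fourierCoeff (f - g) α ^ 2 := sum_le_univ_sum_of_nonneg fun _ => sq_nonneg _
    _ = innerE (f - g) (f - g) := sum_fourierCoeff_sq _

end Distance

section SupportDensity

/-- The proportion of the points of `𝔽₂ⁿ` at which `f` does not vanish. -/
noncomputable def supportDensity (f : F2 n → ℝ) : ℝ := #{x | f x ≠ 0} / 2 ^ n

lemma supportDensity_translate (z : F2 n) (f : F2 n → ℝ) :
    supportDensity (τ z f) = supportDensity f := by
  have : #{x | τ z f x ≠ 0} = #{x | f x ≠ 0} :=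
    card_equiv (Equiv.subRight z) fun x => by
      rw [mem_filter_univ, mem_filter_univ, translate_apply, Equiv.subRight_apply]
  rw [supportDensity, this, supportDensity]

lemma fourierCoeff_sq_le (f : F2 n → ℝ) (α : F2 n) :
    fourierCoeff f α ^ 2 ≤ supportDensity f * innerE f f := by
  have sum_support {u : F2 n → ℝ} (hu : ∀ x, f x = 0 → u x = 0) :
      ∑ x with f x ≠ 0, u x = ∑ x, u x :=
    sum_filter_of_ne fun x _ => mt (hu x)
  have cauchy_schwarz : (∑ x, f x * chi α x) ^ 2 ≤ #{x | f x ≠ 0} * ∑ x, f x * f x := by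
    have h := sq_sum_le_card_mul_sum_sq (s := {x | f x ≠ 0}) (f := fun x => f x * chi α x)
    rw [sum_support fun x hx => by simp [hx], sum_support fun x hx => by simp [hx]] at h
    simpa only [mul_pow, chi_sq, mul_one, ← sq] using h
  calc
    fourierCoeff f α ^ 2 = (1 / 2 ^ n) ^ 2 * (∑ x, f x * chi α x) ^ 2 := mul_pow _ _ 2
    _ ≤ (1 / 2 ^ n) ^ 2 * (#{x | f x ≠ 0} * ∑ x, f x * f x) := by gcongr
    _ = supportDensity f * innerE f f := by rw [supportDensity, innerE]; ring

lemma isFar_sparse (f : F2 n → ℝ) :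
    IsFar ((1 - s * supportDensity f) * innerE f f) f (sparse n s) := by
  convert isFar_sparse_of_fourierCoeff_sq_le (s := s) (fourierCoeff_sq_le f) using 1
  ring

end SupportDensity

section Subcube

/-- The indicator function of the subcube `{x | x i = 0 for all i ∈ S}`, scaled to have
`ℓ₂`-norm `1`. -/
noncomputable def normalizedSubcube (S : Finset (Fin n)) (x : F2 n) : ℝ :=
  if ∀ i ∈ S, x i = 0 then √(2 ^ #S) else 0

lemma card_forall_mem_eq_zero (S : Finset (Fin n)) :
    #{x : F2 n | ∀ i ∈ S, x i = 0} = 2 ^ #Sᶜ := by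
  have : ({x : F2 n | ∀ i ∈ S, x i = 0} : Finset (F2 n)) =
      Fintype.piFinset fun i => if i ∈ S then {0} else univ := by
    ext x
    simp only [mem_filter_univ, Fintype.mem_piFinset]
    refine forall_congr' fun i => ?_
    split_ifs with hi <;> simp [hi]
  rw [this, Fintype.card_piFinset]
  simp only [apply_ite card, card_singleton, card_univ, ZMod.card, prod_ite, prod_const_one,
    one_mul, prod_const, filter_notMem_eq_sdiff, compl_eq_univ_sdiff]

lemma two_pow_card_mul_two_pow_card_compl (S : Finset (Fin n)) :
    (2 : ℝ) ^ #S * 2 ^ #Sᶜ = 2 ^ n := by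
  rw [← pow_add, card_add_card_compl, Fintype.card_fin]

lemma supportDensity_normalizedSubcube (S : Finset (Fin n)) :
    supportDensity (normalizedSubcube S) = 1 / 2 ^ #S := by
  have : #{x : F2 n | normalizedSubcube S x ≠ 0} = 2 ^ #Sᶜ := by
    simp [normalizedSubcube, ← card_forall_mem_eq_zero]
  rw [supportDensity, this, ← two_pow_card_mul_two_pow_card_compl S]
  push_cast
  field_simp

lemma innerE_normalizedSubcube_self (S : Finset (Fin n)) :
    innerE (normalizedSubcube S) (normalizedSubcube S) = 1 := by
  have (x : F2 n) : normalizedSubcube S x * normalizedSubcube S x =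
      if ∀ i ∈ S, x i = 0 then 2 ^ #S else 0 := by
    simp only [normalizedSubcube, ite_zero_mul_ite_zero, and_self,
      Real.mul_self_sqrt (pow_nonneg zero_le_two _)]
  simp only [innerE, this, ← sum_filter, sum_const, card_forall_mem_eq_zero, nsmul_eq_mul,
    Nat.cast_pow, Nat.cast_ofNat]
  rw [mul_comm (2 ^ #Sᶜ), two_pow_card_mul_two_pow_card_compl, one_div_mul_cancel (by positivity)]

lemma normalizedSubcube_mem_sparse (S : Finset (Fin n)) :
    normalizedSubcube S ∈ sparse n (2 ^ #S) := by
  have translate_single {j : Fin n} (hj : j ∉ S) :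
      τ (Pi.single j 1) (normalizedSubcube S) = normalizedSubcube S := by
    funext x
    have (i : Fin n) (hi : i ∈ S) : (x - Pi.single j 1 : F2 n) i = 0 ↔ x i = 0 := by
      rw [Pi.sub_apply, Pi.single_eq_of_ne (ne_of_mem_of_not_mem hi hj), sub_zero]
    simp only [translate_apply, normalizedSubcube, forall₂_congr this]
  have spectrum_subset : {α | fourierCoeff (normalizedSubcube S) α ≠ 0} ⊆
      ({α : F2 n | ∀ i ∈ Sᶜ, α i = 0} : Finset (F2 n)) := by
    intro α hα
    simp only [coe_filter, mem_univ, true_and, Set.mem_ofPred_eq, mem_compl]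
    intro j hj
    by_contra hαj
    refine hα (fourierCoeff_eq_zero_of_translate_eq (translate_single hj) ?_)
    rw [chi_single_one hαj]
    norm_num
  calc
    _ ≤ _ := Set.ncard_le_ncard spectrum_subset (finite_toSet _)
    _ = 2 ^ #S := by rw [Set.ncard_coe_finset, card_forall_mem_eq_zero, compl_compl]

end Subcube

lemma sum_measureReal_sub_mem {Ω G : Type*} [MeasurableSpace Ω] [AddGroup G] [Fintype G]
    (μ : Measure Ω) [IsFiniteMeasure μ] {X : Ω → G} (hX : ∀ y, MeasurableSet (X ⁻¹' {y}))
    (T : Finset G) : ∑ z, μ.real {ω | X ω - z ∈ T} = #T * μ.real Set.univ := by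
  have preimage_sub (z t : G) : (fun ω => X ω - z) ⁻¹' {t} = X ⁻¹' {t + z} := by
    ext ω
    simp [sub_eq_iff_eq_add]
  calc
    ∑ z, μ.real {ω | X ω - z ∈ T} = ∑ z, ∑ t ∈ T, μ.real (X ⁻¹' {t + z}) := by
      refine sum_congr rfl fun z _ => ?_
      have h := sum_measureReal_preimage_singleton (μ := μ) (f := fun ω => X ω - z) T
        fun t _ => preimage_sub z t ▸ hX (t + z)
      simp only [preimage_sub] at h
      exact h.symm
    _ = ∑ t ∈ T, ∑ y, μ.real (X ⁻¹' {y}) := by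
      rw [sum_comm]
      exact sum_congr rfl fun t _ => Equiv.sum_comp (Equiv.addLeft t) fun y => μ.real (X ⁻¹' {y})
    _ = #T * μ.real Set.univ := by
      rw [sum_measureReal_preimage_singleton univ fun y _ => hX y, coe_univ, Set.preimage_univ,
        sum_const, nsmul_eq_mul]

namespace NonAdaptiveAlgorithm

attribute [local instance] measurableSpace isProbabilityMeasure

variable (A : NonAdaptiveAlgorithm n q)

lemma measurableSet_query_apply (i : Fin q) (y : F2 n) :
    MeasurableSet ((A.query · i) ⁻¹' {y}) := by
  have : (A.query · i) ⁻¹' {y} = ⋃ ξ ∈ {ξ : Fin q → F2 n | ξ i = y}, {ω | A.query ω = ξ} := by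
    ext ω
    simp
  rw [this]
  exact .biUnion (Set.to_countable _) fun ξ _ => A.measurableSet_query ξ

lemma measurableSet_run (f : F2 n → ℝ) (b : Bool) : MeasurableSet {ω | A.run f ω = b} := by
  have : {ω | A.run f ω = b} =
      ⋃ ξ : Fin q → F2 n, {ω | A.query ω = ξ} ∩ {ω | A.output ω (f ∘ ξ) = b} := by
    ext ω
    simp [run, Function.comp_def]
  rw [this]
  refine .iUnion fun ξ => (A.measurableSet_query ξ).inter ?_
  exact A.measurable_output.comp (measurable_id.prodMk measurable_const) (measurableSet_singleton b)

lemma prob_true_add_prob_false (f : F2 n → ℝ) : A.prob f true + A.prob f false = 1 := by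
  have : {ω | A.run f ω = false} = {ω | A.run f ω = true}ᶜ := by
    ext ω
    simp
  rw [prob, prob, this, probReal_compl_eq_one_sub (A.measurableSet_run f true), add_sub_cancel]

lemma prob_le_prob_add (f g : F2 n → ℝ) (b : Bool) :
    A.prob f b ≤ A.prob g b + A.law.real {ω | ∃ i, f (A.query ω i) ≠ g (A.query ω i)} := by
  refine (measureReal_mono fun ω hω => ?_).trans (measureReal_union_le _ _)
  by_cases h : ∃ i, f (A.query ω i) ≠ g (A.query ω i)
  · exact .inr h
  · left
    push Not at h
    rwa [Set.mem_ofPred_eq, run, ← funext h]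

lemma exists_translate_prob_query_ne_zero_le (f : F2 n → ℝ) :
    ∃ z, A.law.real {ω | ∃ i, τ z f (A.query ω i) ≠ 0} ≤ q * supportDensity f := by
  have average : ∑ z, A.law.real {ω | ∃ i, τ z f (A.query ω i) ≠ 0} ≤
      ∑ _z : F2 n, q * supportDensity f :=
    calc
      _ ≤ ∑ z, ∑ i, A.law.real {ω | τ z f (A.query ω i) ≠ 0} := by
        gcongr with z
        rw [Set.ofPred_exists]
        exact measureReal_iUnion_fintype_le _
      _ = ∑ _i : Fin q, (#{x | f x ≠ 0} : ℝ) := by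
        rw [sum_comm]
        refine sum_congr rfl fun i _ => ?_
        simpa using sum_measureReal_sub_mem A.law (A.measurableSet_query_apply i) {x | f x ≠ 0}
      _ = ∑ _z : F2 n, q * supportDensity f := by
        simp only [sum_const, card_univ, card_F2, Fintype.card_fin, nsmul_eq_mul, supportDensity,
          Nat.cast_pow, Nat.cast_ofNat]
        field_simp
  obtain ⟨z, -, hz⟩ := exists_le_of_sum_le univ_nonempty average
  exact ⟨z, hz⟩

variable {A}

lemma le_prob_zero_add_of_forall_translate {f : F2 n → ℝ} {b : Bool} {p : ℝ}
    (h : ∀ z, p ≤ A.prob (τ z f) b) : p ≤ A.prob 0 b + q * supportDensity f := by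
  obtain ⟨z, hz⟩ := A.exists_translate_prob_query_ne_zero_le f
  calc
    p ≤ A.prob (τ z f) b := h z
    _ ≤ A.prob 0 b + A.law.real {ω | ∃ i, τ z f (A.query ω i) ≠ 0} := A.prob_le_prob_add _ 0 b
    _ ≤ A.prob 0 b + q * supportDensity f := by gcongr

lemma Distinguishes.one_third_le_mul_supportDensity_add {C : Set (F2 n → ℝ)} {δ ε : ℝ}
    (hA : A.Distinguishes C δ ε) {f g : F2 n → ℝ} (hf : |innerE f f - 1| ≤ ε)
    (hg : |innerE g g - 1| ≤ ε) (hfC : ∀ z, τ z f ∈ C) (hgC : ∀ z, IsFar δ (τ z g) C) :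
    1 / 3 ≤ q * (supportDensity f + supportDensity g) := by
  have norm_translate {u : F2 n → ℝ} (hu : |innerE u u - 1| ≤ ε) (z : F2 n) :
      |l2Norm (τ z u) ^ 2 - 1| ≤ ε := by
    rwa [l2Norm_sq, innerE_translate_self]
  have accept : 2 / 3 ≤ A.prob 0 true + q * supportDensity f :=
    le_prob_zero_add_of_forall_translate fun z => (hA _ (norm_translate hf z)).1 (hfC z)
  have reject : 2 / 3 ≤ A.prob 0 false + q * supportDensity g :=
    le_prob_zero_add_of_forall_translate fun z => (hA _ (norm_translate hg z)).2 (hgC z)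
  linarith [A.prob_true_add_prob_false 0]

lemma Distinguishes.two_pow_le_six_mul {k : ℕ} (hk : k ≤ n) (hks : 2 ^ k ≤ s) {δ ε : ℝ}
    (hδ : δ ≤ 1 - s / 2 ^ n) (hε : 0 ≤ ε) (hA : A.Distinguishes (sparse n s) δ ε) :
    (2 : ℝ) ^ k ≤ 6 * q := by
  obtain ⟨S, -, rfl⟩ := exists_subset_card_eq (s := (univ : Finset (Fin n))) (by simpa using hk)
  have norm_one (T : Finset (Fin n)) :
      |innerE (normalizedSubcube T) (normalizedSubcube T) - 1| ≤ ε := by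
    rwa [innerE_normalizedSubcube_self, sub_self, abs_zero]
  have subcube_sparse (z : F2 n) : τ z (normalizedSubcube S) ∈ sparse n s :=
    translate_mem_sparse z ((normalizedSubcube_mem_sparse S).trans hks)
  have point_far (z : F2 n) : IsFar δ (τ z (normalizedSubcube univ)) (sparse n s) := by
    have h := isFar_sparse (s := s) (τ z (normalizedSubcube (univ : Finset (Fin n))))
    rw [supportDensity_translate, supportDensity_normalizedSubcube, innerE_translate_self,
      innerE_normalizedSubcube_self, card_univ, Fintype.card_fin, mul_one, mul_one_div] at h
    exact hδ.trans h
  have h := hA.one_third_le_mul_supportDensity_add (norm_one S) (norm_one univ) subcube_sparse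
    point_far
  rw [supportDensity_normalizedSubcube, supportDensity_normalizedSubcube, card_univ,
    Fintype.card_fin] at h
  have density_le : (1 : ℝ) / 2 ^ n ≤ 1 / 2 ^ #S := by gcongr; exact one_le_two
  have one_third_le : (1 / 3 : ℝ) ≤ 2 * q / 2 ^ #S :=
    calc
      (1 / 3 : ℝ) ≤ q * (1 / 2 ^ #S + 1 / 2 ^ n) := h
      _ ≤ q * (1 / 2 ^ #S + 1 / 2 ^ #S) := by gcongr
      _ = 2 * q / 2 ^ #S := by ring
  rw [le_div_iff₀ (by positivity)] at one_third_le
  linarith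

end NonAdaptiveAlgorithm

lemma natCast_div_two_pow_le_half (hn : 1 ≤ n) (hs : s ≤ 2 ^ (n - 1)) :
    (s : ℝ) / 2 ^ n ≤ 1 / 2 := by
  have : s * 2 ≤ 2 ^ n := by
    rw [← Nat.sub_add_cancel hn, pow_succ]
    exact Nat.mul_le_mul_right 2 hs
  rw [div_le_div_iff₀ (by positivity) two_pos, one_mul]
  exact_mod_cast this

lemma sqrt_natCast_le (s : ℕ) : √(s : ℝ) ≤ s :=
  Real.sqrt_le_self_iff.mpr (by exact_mod_cast Nat.eq_zero_or_pos s)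

end FourierSparsity

open FourierSparsity in
theorem mainTheorem2_general {n s q : ℕ} {δ ε : ℝ} (hδ₀ : 0 ≤ δ) (hδ : δ ≤ 1 - s / 2 ^ n)
    (hε : 0 ≤ ε) {A : NonAdaptiveAlgorithm n q} (hA : A.Distinguishes (sparse n s) δ ε) :
    (s : ℝ) / 12 ≤ q := by
  rcases eq_or_ne s 0 with rfl | hs
  · simp
  have le_two_pow : s ≤ 2 ^ n := by
    have : (s : ℝ) / 2 ^ n ≤ 1 := by linarith
    exact_mod_cast (div_le_one (by positivity)).mp this
  have log_le : Nat.log 2 s ≤ n := by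
    simpa using Nat.log_mono_right (b := 2) le_two_pow
  have lower := hA.two_pow_le_six_mul log_le (Nat.pow_log_le_self 2 hs) hδ hε
  have upper : (s : ℝ) ≤ 2 * 2 ^ Nat.log 2 s := by
    rw [← pow_succ']
    exact_mod_cast (Nat.lt_pow_succ_log_self one_lt_two s).le
  linarith

theorem mainTheorem2 :
    ∃ c : ℝ, 0 < c ∧
      ∀ (n s : ℕ), 1 ≤ n → s ≤ 2 ^ (n - 1) →
        ∀ ε : ℝ, 0 < ε →
          ∀ (q : ℕ) (A : FourierSparsity.NonAdaptiveAlgorithm n q),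
            A.Distinguishes (FourierSparsity.sparse n s) (1 / 3) ε →
              c * Real.sqrt s ≤ q := by
  refine ⟨1 / 12, by norm_num, fun n s hn hs ε hε q A hA => ?_⟩
  have hδ : (1 / 3 : ℝ) ≤ 1 - s / 2 ^ n := by
    linarith [FourierSparsity.natCast_div_two_pow_le_half hn hs]
  linarith [mainTheorem2_general (by norm_num) hδ hε.le hA, FourierSparsity.sqrt_natCast_le s]
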